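/- **Theorem 4 (Generic direction-slider network realization).** Let $G$ be a finite multigraph with $n$ vertices, $m$ (non-loop) edges and $c$ loops; parallel edges and several loops at a vertex are allowed. $G$ is *looped-Laman* if (i) every loopless subgraph of $G$ on $n'$ vertices with $m'\ge 1$ edges satisfies $m'\le 2n'-3$; (ii) every subgraph of $G$ on $n'$ vertices with $m'$ edges and $c'$ loops satisfies $m'+c'\le 2n'$; and (iii) $m+c=2n$. A *direction-slider network* $(G,\vec d,\vec n,\vec s)$ assigns to each non-loop edge $e$ of $G$ a direction vector $\vec d_e\in\mathbb R^2$, and to each loop $l$ of $G$ a vector $\vec n_l\in\mathbb R^2$ and a number $s_l\in\mathbb R$, which define the slider line $\langle \vec n_l,\vec x\rangle=s_l$. A *realization* assigns to each vertex $i$ of $G$ a point $\vec p_i\in\mathbb R^2$ such that $\langle \vec p_i-\vec p_j,\vec d_e^{\perp}\rangle=0$ for every non-loop edge $e$ with ends $i,j$ (where $\vec d^{\perp}$ is $\vec d$ rotated by a quarter turn), and $\langle \vec n_l,\vec p_i\rangle=s_l$ for every loop $l$ at a vertex $i$. It is *faithful* if $\vec p_i\ne\vec p_j$ whenever $i,j$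 are the ends of a non-loop edge. Then for every generic direction-slider network $(G,\vec d,\vec n,\vec s)$, that is, for all $(\vec d,\vec n,\vec s)\in\mathbb R^{2m+3c}$ outside some proper algebraic subset (depending on $G$) defined by finitely many real polynomials: 1. $(G,\vec d,\vec n,\vec s)$ has a unique faithful realization if and only if $G$ is looped-Laman; 2. if $m+c=2n$, then $(G,\vec d,\vec n,\vec s)$ has a faithful realization if and only if $G$ is looped-Laman. -/

import Mathlib

open scoped Graph Matrix

/-! ### Sparse and graded-sparse multigraphs

`Graph α β` is Mathlib's type of multigraphs; parallel edges and (multiple) loops are allowed, and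
`E(G)` contains both the edges proper (non-loops) and the loops of `G`. -/

namespace Graph

/-- `G` is `(k, ℓ)`-sparse: every subgraph of `G` with at least one edge or loop, on `n'` vertices,
has at most `k n' - ℓ` edges and loops. (As usual, subgraphs with no edge and no loop are not
subject to the count.) Meant for finite graphs. -/
def IsSparse (k ℓ : ℕ) {α β : Type*} (G : Graph α β) : Prop :=
  ∀ H : Graph α β, H ≤ G → E(H).Nonempty → E(H).ncard + ℓ ≤ k * V(H).ncard

/-- `G` is `(2,0,3)`-graded-sparse: its subgraphs without loops are `(2,3)`-sparse, and all its
subgraphs are `(2,0)`-sparse. -/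
def IsGradedSparse203 {α β : Type*} (G : Graph α β) : Prop :=
  (∀ H : Graph α β, H ≤ G → H.Loopless → H.IsSparse 2 3) ∧
    (∀ H : Graph α β, H ≤ G → H.IsSparse 2 0)

/-- `G` is looped-Laman, i.e. `(2,0,3)`-tight: it is `(2,0,3)`-graded-sparse and has exactly twice
as many edges and loops as vertices. -/
def IsLoopedLaman {α β : Type*} (G : Graph α β) : Prop :=
  G.IsGradedSparse203 ∧ E(G).ncard = 2 * V(G).ncard

/-- The edges proper of `G`, i.e. the members of `E(G)` that are not loops. -/
def ProperEdge {α β : Type*} (G : Graph α β) : Type _ := {e : β // ∃ x, G.IsNonloopAt e x}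

/-- The loops of `G`. -/
def LoopEdge {α β : Type*} (G : Graph α β) : Type _ := {e : β // ∃ x, G.IsLoopAt e x}

end Graph

/-! ### Direction-slider networks -/

/-- A direction-slider network with underlying looped multigraph `G`: a direction in `ℝ²` for every
non-loop edge, and a slider, the line `⟨normal l, x⟩ = offset l`, for every loop `l`. -/
structure DirectionSliderNetwork {α β : Type*} (G : Graph α β) where
  /-- The direction assigned to each non-loop edge. -/
  dir : G.ProperEdge → Fin 2 → ℝ
  /-- The normal vector of the slider of each loop. -/
  normal : G.LoopEdge → Fin 2 → ℝ
  /-- The right-hand side of the equation of the slider of each loop. -/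
  offset : G.LoopEdge → ℝ

namespace DirectionSliderNetwork

variable {α β : Type*} {G : Graph α β}

/-- The vector `v` rotated by a quarter turn. -/
def perp (v : Fin 2 → ℝ) : Fin 2 → ℝ := ![-v 1, v 0]

/-- The placement `p` of the vertices of `G` in the plane is a realization of the network `N`: each
non-loop edge `ij` is drawn in its direction, `⟨p i - p j, dᵢⱼ^⊥⟩ = 0` (this does not depend on the
order of `i` and `j`), and each vertex lies on the lines of all its sliders. -/
def IsRealization (N : DirectionSliderNetwork G) (p : V(G) → Fin 2 → ℝ) : Prop :=
  (∀ (e : G.ProperEdge) (i j : V(G)), G.IsLink e.1 i j → (p i - p j) ⬝ᵥ perp (N.dir e) = 0) ∧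
    (∀ (l : G.LoopEdge) (i : V(G)), G.IsLoopAt l.1 i → N.normal l ⬝ᵥ p i = N.offset l)

/-- A realization is faithful if no non-loop edge is collapsed to a point. -/
def IsFaithfulRealization (N : DirectionSliderNetwork G) (p : V(G) → Fin 2 → ℝ) : Prop :=
  N.IsRealization p ∧ ∀ (e : G.ProperEdge) (i j : V(G)), G.IsLink e.1 i j → p i ≠ p j

/-- Index set of the `2m + 3c` coordinates of `(d, n, s)`, for `m` non-loop edges and `c` loops. -/
abbrev Coord {α β : Type*} (G : Graph α β) : Type _ :=
  (G.ProperEdge × Fin 2) ⊕ (G.LoopEdge × Fin 2) ⊕ G.LoopEdge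

/-- The network as a point `(d, n, s)` of `ℝ^(2m+3c)`. -/
def coords (N : DirectionSliderNetwork G) : Coord G → ℝ :=
  Sum.elim (fun x => N.dir x.1 x.2) (Sum.elim (fun x => N.normal x.1 x.2) N.offset)

/-- `P` holds for every generic direction-slider network on `G`: it holds for all `(d, n, s)` in the
complement of an algebraic subset of `ℝ^(2m+3c)`, the set of common zeros of finitely many
polynomials with real coefficients, not all of which are zero (so the complement is open and
dense). -/
def HoldsGenerically (G : Graph α β) (P : DirectionSliderNetwork G → Prop) : Prop :=
  ∃ F : Finset (MvPolynomial (Coord G) ℝ), (∃ f ∈ F, f ≠ 0) ∧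
    ∀ N : DirectionSliderNetwork G, (¬ ∀ f ∈ F, MvPolynomial.eval N.coords f = 0) → P N

end DirectionSliderNetwork

/-! Realizations solve a linear system with two unknowns per vertex and one equation per edge or
loop: the row of an edge `ij` is `(χ_i - χ_j) ⊗ d^⊥`, that of a loop at `i` is `χ_i ⊗ n`.

Necessity. In a faithful realization every direction is a multiple of its edge vector, so the
faithfully realizable networks are images under a polynomial map. If a sparsity count fails, the map
has fewer variables than coordinates and its image lies in a hypersurface
(`generic_not_exists_eval`). If both counts hold but tightness fails, the system is underdetermined,
and a kernel vector deforms any faithful realization into another one.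

Sufficiency. The counts give Rado's condition for the spaces `u_i ⊗ ℝ²`, with `u_i` the incidence
vectors, so suitable, hence generic, directions and normals make the rows independent; by tightness
the system is square and has one solution. For faithfulness, doubling an edge `e₀` turns
`(2,3)`-sparsity of the loopless part into `(2,2)`-sparsity, so some solution of the edge equations
keeps the ends of `e₀` apart. Offsets can be chosen to make it a realization, and a bordered matrix
spreads non-collapse from that network to generic ones (`generic_forall_realizes_ne`). -/

open Module in
/-- Rado's theorem for subspaces of a vector space. -/
theorem exists_linearIndependent_of_card_le_finrank_sup {K X ι : Type*} [Field K] [AddCommGroup X]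
    [Module K X] [FiniteDimensional K X] [Fintype ι] (A : ι → Submodule K X)
    (h : ∀ S : Finset ι, S.card ≤ finrank K ↥(S.sup A)) :
    ∃ x : ι → X, (∀ i, x i ∈ A i) ∧ LinearIndependent K x := by
  classical
  induction hn : ∑ i, finrank K (A i) using Nat.strong_induction_on generalizing A with
  | _ n ih =>
  subst hn
  -- Shrinking `A i` to `B` lowers the total dimension, and Rado's condition needs rechecking only
  -- on index sets containing `i`.
  have key : ∀ (i : ι) (B : Submodule K X), B < A i →
      (∀ S : Finset ι, i ∉ S → S.card + 1 ≤ finrank K ↥(S.sup A ⊔ B)) →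
      ∃ x : ι → X, (∀ i, x i ∈ A i) ∧ LinearIndependent K x := by
    intro i B hB hS
    have hle : ∀ j, Function.update A i B j ≤ A j := by
      intro j
      by_cases hj : j = i
      · subst hj; simpa using hB.le
      · simp [hj]
    have hsup : ∀ S : Finset ι, i ∉ S → S.sup (Function.update A i B) = S.sup A := by
      intro S hi
      refine Finset.sup_congr rfl fun j hj => ?_
      rw [Function.update_of_ne]
      rintro rfl
      exact hi hj
    obtain ⟨x, hx, hx'⟩ := ih (∑ j, finrank K (Function.update A i B j)) (by
        refine Finset.sum_lt_sum (fun j _ => Submodule.finrank_mono (hle j)) ⟨i, by simp, ?_⟩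
        rw [Function.update_self]
        exact Submodule.finrank_lt_finrank_of_lt hB) (Function.update A i B) (by
        intro S
        by_cases hi : i ∈ S
        · rw [← Finset.insert_erase hi, Finset.sup_insert, hsup _ (by simp),
            Finset.card_insert_of_notMem (by simp), Function.update_self, sup_comm]
          exact hS _ (by simp)
        · rw [hsup S hi]; exact h S) rfl
    exact ⟨x, fun j => hle j (hx j), hx'⟩
  by_cases hone : ∀ i, finrank K (A i) ≤ 1
  · have : ∀ i, ∃ x : X, A i = K ∙ x := by
      intro i
      obtain ⟨v, hv⟩ := finrank_le_one_iff.1 (hone i)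
      refine ⟨v, le_antisymm (fun y hy => ?_) ?_⟩
      · obtain ⟨c, hc⟩ := hv ⟨y, hy⟩
        exact Submodule.mem_span_singleton.2 ⟨c, congrArg Subtype.val hc⟩
      · simp
    choose x hx using this
    refine ⟨x, fun i => by rw [hx]; exact Submodule.mem_span_singleton_self _, ?_⟩
    rw [linearIndependent_iff_card_le_finrank_span]
    have h' := h Finset.univ
    rwa [Finset.sup_univ_eq_iSup, funext hx, ← Submodule.span_range_eq_iSup] at h'
  · push Not at hone
    obtain ⟨i, hi⟩ := hone
    obtain ⟨x, hx, hx0⟩ : ∃ x ∈ A i, x ≠ 0 := by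
      refine (Submodule.ne_bot_iff _).1 ?_
      intro hbot
      rw [hbot] at hi
      simp at hi
    set B : Submodule K X := K ∙ x with hBdef
    have hBle : B ≤ A i := by simpa [hBdef] using hx
    obtain ⟨C₀, hC₀⟩ := exists_isCompl B
    set C := C₀ ⊓ A i with hCdef
    have hBC : B ⊔ C = A i := by
      rw [hCdef, ← sup_inf_assoc_of_le _ hBle, hC₀.sup_eq_top, top_inf_eq]
    have hB : B < A i := by
      refine lt_of_le_of_ne hBle fun he => ?_
      rw [← he, hBdef, finrank_span_singleton hx0] at hi
      omega
    have hC : C < A i := by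
      refine lt_of_le_of_ne inf_le_right fun he => hx0 ?_
      have h1 : x ∈ C₀ := (inf_eq_right.1 he) hx
      exact (Submodule.mem_bot K).1 (hC₀.inf_eq_bot ▸ ⟨Submodule.mem_span_singleton_self x, h1⟩)
    -- If neither `B` nor `C` can replace `A i = B ⊔ C`, sets `S` and `T` witness the failures.
    -- Modularity of dimension contradicts this: the join contains the spaces of `S ∪ T ∪ {i}`, the
    -- meet those of `S ∩ T`, and together they need dimension `|S| + |T| + 1`.
    by_contra hcon
    have h1 := mt (key i B hB) hcon
    have h2 := mt (key i C hC) hcon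
    push Not at h1 h2
    obtain ⟨S, hiS, hS⟩ := h1
    obtain ⟨T, hiT, hT⟩ := h2
    have h3 := Submodule.finrank_sup_add_finrank_inf_eq (S.sup A ⊔ B) (T.sup A ⊔ C)
    have h4 : (insert i (S ∪ T)).sup A ≤ (S.sup A ⊔ B) ⊔ (T.sup A ⊔ C) := by
      rw [Finset.sup_insert, Finset.sup_union, ← hBC]
      exact (le_of_eq (by ac_rfl))
    have h5 : (S ∩ T).sup A ≤ (S.sup A ⊔ B) ⊓ (T.sup A ⊔ C) :=
      le_inf ((Finset.sup_mono Finset.inter_subset_left).trans le_sup_left)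
        ((Finset.sup_mono Finset.inter_subset_right).trans le_sup_left)
    have h6 := (h _).trans (Submodule.finrank_mono h4)
    have h7 := (h _).trans (Submodule.finrank_mono h5)
    rw [Finset.card_insert_of_notMem (by simp [hiS, hiT])] at h6
    have h8 := Finset.card_union_add_card_inter S T
    omega

/-! ### Linear systems with independent rows -/

namespace Matrix

variable {m n : Type*} [Fintype m] [Fintype n]

theorem mulVec_surjective_of_linearIndependent_row {K : Type*} [Field K] {A : Matrix m n K}
    (hA : LinearIndependent K A.row) : Function.Surjective A.mulVec := by
  classical
  have h : A.rank = Fintype.card m := hA.rank_matrix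
  have : LinearMap.range A.mulVecLin = ⊤ := by
    apply Submodule.eq_top_of_finrank_eq
    rw [← Matrix.rank, h, Module.finrank_fintype_fun_eq_card]
  exact LinearMap.range_eq_top.1 this

theorem mulVec_injective_of_linearIndependent_row {K : Type*} [Field K] {A : Matrix m n K}
    (hA : LinearIndependent K A.row) (hmn : Fintype.card m = Fintype.card n) :
    Function.Injective A.mulVec := by
  have h : Function.Surjective A.mulVecLin := mulVec_surjective_of_linearIndependent_row hA
  exact (LinearMap.injective_iff_surjective_of_finrank_eq_finrank (by simp [hmn])).2 h

end Matrix

/-! ### Generic properties -/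

namespace MvPolynomial

/-- `P` holds on the complement of the zero set of some nonzero polynomial. -/
def Generic {σ : Type*} (P : (σ → ℝ) → Prop) : Prop :=
  ∃ f : MvPolynomial σ ℝ, f ≠ 0 ∧ ∀ x, eval x f ≠ 0 → P x

variable {σ : Type*} {P Q : (σ → ℝ) → Prop}

theorem Generic.mono (h : Generic P) (hPQ : ∀ x, P x → Q x) : Generic Q :=
  let ⟨f, hf, hfP⟩ := h
  ⟨f, hf, fun x hx => hPQ x (hfP x hx)⟩

theorem Generic.and (h : Generic P) (h' : Generic Q) : Generic fun x => P x ∧ Q x :=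
  let ⟨f, hf, hfP⟩ := h
  let ⟨g, hg, hgQ⟩ := h'
  ⟨f * g, mul_ne_zero hf hg, fun x hx => by
    rw [map_mul] at hx
    exact ⟨hfP x (left_ne_zero_of_mul hx), hgQ x (right_ne_zero_of_mul hx)⟩⟩

theorem Generic.forall {ι : Type*} [Fintype ι] {P : ι → (σ → ℝ) → Prop}
    (h : ∀ i, Generic (P i)) : Generic fun x => ∀ i, P i x := by
  choose f hf hfP using h
  refine ⟨∏ i, f i, Finset.prod_ne_zero_iff.2 fun i _ => hf i, fun x hx i => hfP i x ?_⟩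
  rw [map_prod] at hx
  exact Finset.prod_ne_zero_iff.1 hx i (Finset.mem_univ i)

theorem Generic.exists (h : Generic P) : ∃ x, P x := by
  obtain ⟨f, hf, hfP⟩ := h
  by_contra hcon
  push Not at hcon
  refine hf (MvPolynomial.funext fun x => ?_)
  by_contra hx
  exact hcon x (hfP x (by simpa using hx))

theorem Generic.of_forall (h : ∀ x, P x) : Generic P := ⟨1, one_ne_zero, fun x _ => h x⟩

/-- Linear independence of the rows of a polynomial matrix is an open condition. -/
theorem generic_linearIndependent_row {m n : Type*} [Fintype m] [Fintype n]
    (A : Matrix m n (MvPolynomial σ ℝ)) (x₀ : σ → ℝ)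
    (h : LinearIndependent ℝ (A.map (eval x₀)).row) :
    Generic fun x => LinearIndependent ℝ (A.map (eval x)).row := by
  classical
  have hdet : ∀ x, eval x (A * Aᵀ).det = (A.map (eval x) * (A.map (eval x))ᵀ).det := by
    intro x
    rw [RingHom.map_det, RingHom.mapMatrix_apply, Matrix.map_mul, Matrix.transpose_map]
  -- The Gram determinant detects independence, since over `ℝ` the matrices `A` and `A * Aᵀ` have
  -- the same rank.
  have key : ∀ x, eval x (A * Aᵀ).det ≠ 0 ↔ LinearIndependent ℝ (A.map (eval x)).row := by
    intro x
    rw [hdet, ← Matrix.vecMul_injective_iff, ← isUnit_iff_ne_zero, ← Matrix.isUnit_iff_isUnit_det,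
      ← Matrix.vecMul_injective_iff_isUnit]
    constructor
    · intro hi a b hab
      apply hi
      simp only [← Matrix.vecMul_vecMul]
      rw [show a ᵥ* A.map (eval x) = b ᵥ* A.map (eval x) from hab]
    · intro hi
      rw [Matrix.vecMul_injective_iff] at hi ⊢
      have h1 := hi.rank_matrix
      rw [← Matrix.rank_self_mul_transpose] at h1
      rw [linearIndependent_iff_card_le_finrank_span]
      rw [Matrix.rank_eq_finrank_span_row] at h1
      exact h1.ge
  refine ⟨(A * Aᵀ).det, fun h0 => (key x₀).2 h (by simp [h0]), fun x hx => (key x).1 hx⟩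

/-- The image of a polynomial map from a space of smaller dimension is contained in a
hypersurface. -/
theorem generic_not_exists_eval {σ' τ : Type*} [Fintype σ'] [Fintype τ]
    (hcard : Fintype.card τ < Fintype.card σ') (g : σ' → σ) (hg : Function.Injective g)
    (f : σ' → MvPolynomial τ ℝ) :
    Generic fun x : σ → ℝ => ¬ ∃ y : τ → ℝ, ∀ j, x (g j) = eval y (f j) := by
  -- The transcendence degree of the polynomial ring is the number of variables, so the `f j` are
  -- too many to be independent; a relation between them cuts out the hypersurface.
  have hdep : ¬ AlgebraicIndependent ℝ f := by
    intro hf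
    have h := hf.lift_cardinalMk_le_trdeg
    rw [MvPolynomial.trdeg_of_isDomain] at h
    simp only [Cardinal.mk_fintype, Cardinal.lift_natCast, Nat.cast_le] at h
    omega
  rw [algebraicIndependent_iff] at hdep
  push Not at hdep
  obtain ⟨F, hF, hF0⟩ := hdep
  refine ⟨rename g F, fun h => hF0 (rename_injective g hg (by simpa using h)), ?_⟩
  rintro x hx ⟨y, hy⟩
  apply hx
  have h1 := congrArg (eval y) hF
  rw [eval_rename, show x ∘ g = fun j => eval y (f j) from _root_.funext hy]
  rw [map_aeval, map_zero, algebraMap_eq, show (eval y).comp (C : ℝ →+* _) = RingHom.id ℝ from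
    RingHom.ext fun r => eval_C r] at h1
  exact h1

end MvPolynomial

/-! ### Networks on a multigraph with oriented edges -/

namespace DirectionSliderNetwork

open MvPolynomial

theorem exists_smul_of_dotProduct_perp_eq_zero {w d : Fin 2 → ℝ} (hw : w ≠ 0)
    (h : w ⬝ᵥ perp d = 0) : ∃ c : ℝ, d = c • w := by
  simp only [dotProduct, perp, Fin.sum_univ_two, Matrix.cons_val_zero, Matrix.cons_val_one] at h
  by_cases h0 : w 0 = 0
  · have h1 : w 1 ≠ 0 := fun h1 => hw (by ext k; fin_cases k <;> simp [h0, h1])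
    refine ⟨d 1 / w 1, ?_⟩
    have : d 0 = 0 := by
      rw [h0] at h
      simpa [h1] using h
    ext k
    fin_cases k <;> simp [h0, h1, this]
  · refine ⟨d 0 / w 0, ?_⟩
    ext k
    fin_cases k <;> simp [h0]
    field_simp
    linarith

section Multigraph

variable {V P L : Type*} (s t : P → V) (b : L → V)

/-- The coordinates `(d, n, s)` of a network with edges `P` and sliders `L`. -/
abbrev ParamIndex (P L : Type*) : Type _ := (P × Fin 2) ⊕ (L × Fin 2) ⊕ L

/-- The placement `p` realizes the network with coordinates `x` on the multigraph whose edges `e`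
join `s e` and `t e`, and whose loops `l` are attached at `b l`. -/
def Realizes (x : ParamIndex P L → ℝ) (p : V → Fin 2 → ℝ) : Prop :=
  (∀ e, (p (s e) - p (t e)) ⬝ᵥ perp (fun k => x (.inl (e, k))) = 0) ∧
    ∀ l, (fun k => x (.inr (.inl (l, k)))) ⬝ᵥ p (b l) = x (.inr (.inr l))

/-- A realization which collapses no edge. -/
def FaithfullyRealizes (x : ParamIndex P L → ℝ) (p : V → Fin 2 → ℝ) : Prop :=
  Realizes s t b x p ∧ ∀ e, p (s e) ≠ p (t e)

/-! ### Necessity of the sparsity counts -/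

section Induced

variable [Fintype P]

open Classical in
/-- The edges with both ends in `X`. -/
noncomputable def inducedEdges (X : Finset V) : Finset P := {e | s e ∈ X ∧ t e ∈ X}

open Classical in
/-- The loops attached at vertices of `X`. -/
noncomputable def inducedLoops [Fintype L] (X : Finset V) : Finset L := {l | b l ∈ X}

variable {s t b} in
@[simp] theorem mem_inducedEdges {X : Finset V} {e : P} :
    e ∈ inducedEdges s t X ↔ s e ∈ X ∧ t e ∈ X := by simp [inducedEdges]

variable {b} in
@[simp] theorem mem_inducedLoops [Fintype L] {X : Finset V} {l : L} :
    l ∈ inducedLoops b X ↔ b l ∈ X := by simp [inducedLoops]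

/-- Dimension count on the part induced by `X`, with `S` its edges and `T` its loops: the points,
one scalar per edge and the normals determine the directions and offsets. These are `2|X| + |S| +
2|T|` parameters for `2|S| + 3|T|` coordinates. -/
theorem generic_not_exists_faithfullyRealizes_of_card_lt [Fintype L] (X : Finset V)
    (hX : 2 * X.card < (inducedEdges s t X).card + (inducedLoops b X).card) :
    Generic fun x : ParamIndex P L → ℝ => ¬ ∃ p, FaithfullyRealizes s t b x p := by
  classical
  set S := inducedEdges s t X
  set T := inducedLoops b X
  let p' : X → Fin 2 → MvPolynomial ((X × Fin 2) ⊕ S ⊕ (T × Fin 2)) ℝ :=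
    fun v k => MvPolynomial.X (.inl (v, k))
  let f : ParamIndex S T → MvPolynomial ((X × Fin 2) ⊕ S ⊕ (T × Fin 2)) ℝ :=
    Sum.elim
      (fun ek => MvPolynomial.X (.inr (.inl ek.1)) *
        (p' ⟨s ek.1, (mem_inducedEdges.1 ek.1.2).1⟩ ek.2 -
          p' ⟨t ek.1, (mem_inducedEdges.1 ek.1.2).2⟩ ek.2))
      (Sum.elim (fun lk => MvPolynomial.X (.inr (.inr lk)))
        (fun l => ∑ k, MvPolynomial.X (.inr (.inr (l, k))) *
          p' ⟨b l, mem_inducedLoops.1 l.2⟩ k))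
  let g : ParamIndex S T → ParamIndex P L :=
    Sum.map (Prod.map Subtype.val id) (Sum.map (Prod.map Subtype.val id) Subtype.val)
  have hg : Function.Injective g :=
    (Subtype.val_injective.prodMap Function.injective_id).sumMap
      ((Subtype.val_injective.prodMap Function.injective_id).sumMap Subtype.val_injective)
  refine (generic_not_exists_eval (by simp; omega) g hg f).mono ?_
  rintro x hx ⟨p, ⟨hpe, hpl⟩, hpf⟩
  apply hx
  have hc : ∀ e, ∃ c : ℝ, (fun k => x (.inl (e, k))) = c • (p (s e) - p (t e)) := fun e =>
    exists_smul_of_dotProduct_perp_eq_zero (sub_ne_zero.2 (hpf e)) (hpe e)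
  choose c hc using hc
  refine ⟨Sum.elim (fun vk => p vk.1 vk.2)
    (Sum.elim (fun e => c e) fun lk => x (.inr (.inl (lk.1, lk.2)))), ?_⟩
  rintro (⟨e, k⟩ | ⟨l, k⟩ | l)
  · simpa [f, g, p'] using congrFun (hc e) k
  · simp [f, g]
  · simpa [f, g, p', dotProduct] using (hpl l).symm

/-- Directions alone are unchanged by translating and scaling the points. Placing one end of `e₀` at
the origin and giving `e₀` the scalar `1` saves three parameters, leaving `2|X| + |S| - 3` for
`2|S|` coordinates. -/
theorem generic_not_exists_faithfullyRealizes_of_card_lt_add_three (X : Finset V)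
    (hne : (inducedEdges s t X).Nonempty)
    (hX : 2 * X.card < (inducedEdges s t X).card + 3) :
    Generic fun x : ParamIndex P L → ℝ => ¬ ∃ p, FaithfullyRealizes s t b x p := by
  classical
  obtain ⟨e₀, he₀⟩ := hne
  set S := inducedEdges s t X
  set v₀ := s e₀
  have hv₀ : v₀ ∈ X := (mem_inducedEdges.1 he₀).1
  let τ := (X.erase v₀ × Fin 2) ⊕ S.erase e₀
  let p' : X → Fin 2 → MvPolynomial τ ℝ := fun v k =>
    if h : v.1 = v₀ then 0 else MvPolynomial.X (.inl (⟨v.1, Finset.mem_erase.2 ⟨h, v.2⟩⟩, k))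
  let c' : S → MvPolynomial τ ℝ := fun e =>
    if h : e.1 = e₀ then 1 else MvPolynomial.X (.inr ⟨e.1, Finset.mem_erase.2 ⟨h, e.2⟩⟩)
  let f : S × Fin 2 → MvPolynomial τ ℝ := fun ek => c' ek.1 *
    (p' ⟨s ek.1, (mem_inducedEdges.1 ek.1.2).1⟩ ek.2 -
          p' ⟨t ek.1, (mem_inducedEdges.1 ek.1.2).2⟩ ek.2)
  let g : S × Fin 2 → ParamIndex P L := fun ek => .inl (ek.1, ek.2)
  have hg : Function.Injective g :=
    Sum.inl_injective.comp (Subtype.val_injective.prodMap Function.injective_id)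
  -- A nonzero direction on `e₀` forces a nonzero scalar `c e₀`, by which the normalization divides.
  have h1 : Generic fun x : ParamIndex P L → ℝ => x (.inl (e₀, 0)) ≠ 0 :=
    ⟨MvPolynomial.X (.inl (e₀, 0)), X_ne_zero _, fun x hx => by simpa using hx⟩
  have hcard : Fintype.card τ < Fintype.card (S × Fin 2) := by
    have h2 := Finset.card_pos.2 ⟨_, he₀⟩
    have h3 := Finset.card_pos.2 ⟨_, hv₀⟩
    simp only [τ, Fintype.card_sum, Fintype.card_prod, Fintype.card_coe, Fintype.card_fin,
      Finset.card_erase_of_mem he₀, Finset.card_erase_of_mem hv₀]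
    omega
  refine ((generic_not_exists_eval hcard g hg f).and h1).mono ?_
  rintro x ⟨hx, hx0⟩ ⟨p, ⟨hpe, hpl⟩, hpf⟩
  apply hx
  have hc : ∀ e, ∃ c : ℝ, (fun k => x (.inl (e, k))) = c • (p (s e) - p (t e)) := fun e =>
    exists_smul_of_dotProduct_perp_eq_zero (sub_ne_zero.2 (hpf e)) (hpe e)
  choose c hc using hc
  have hc0 : c e₀ ≠ 0 := by
    intro h
    apply hx0
    simpa [h] using congrFun (hc e₀) 0
  let y : τ → ℝ := Sum.elim (fun vk => c e₀ * (p vk.1 vk.2 - p v₀ vk.2)) fun e => c e / c e₀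
  have hp' : ∀ v k, eval y (p' v k) = c e₀ * (p v k - p v₀ k) := by
    intro v k
    by_cases h : v.1 = v₀ <;> simp [p', h, y]
  have hc' : ∀ e, eval y (c' e) = c e / c e₀ := by
    intro e
    by_cases h : e.1 = e₀
    · simp [c', h, hc0]
    · simp [c', h, y]
  refine ⟨y, ?_⟩
  rintro ⟨e, k⟩
  have h := congrFun (hc e) k
  simp only [Pi.smul_apply, Pi.sub_apply, smul_eq_mul] at h
  simp only [g, f, map_mul, map_sub, hp', hc', h]
  field_simp
  ring

end Induced

/-- An underdetermined network has no unique faithful realization. -/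
theorem not_existsUnique_faithfullyRealizes [Fintype V] [Fintype P] [Fintype L]
    (hcard : Fintype.card P + Fintype.card L < 2 * Fintype.card V) (x : ParamIndex P L → ℝ) :
    ¬ ∃! p, FaithfullyRealizes s t b x p := by
  rintro ⟨p, ⟨⟨hpe, hpl⟩, hpf⟩, huniq⟩
  let φ : (V → Fin 2 → ℝ) →ₗ[ℝ] (P ⊕ L → ℝ) :=
    { toFun := fun q => Sum.elim
        (fun e => (q (s e) - q (t e)) ⬝ᵥ perp (fun k => x (.inl (e, k))))
        (fun l => (fun k => x (.inr (.inl (l, k)))) ⬝ᵥ q (b l))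
      map_add' := by
        intro q r
        ext (e | l)
        · simp [add_sub_add_comm, add_dotProduct]
        · simp [dotProduct_add]
      map_smul' := by
        intro a q
        ext (e | l)
        · simp [← smul_sub, smul_dotProduct]
        · simp [dotProduct_smul] }
  obtain ⟨q, hq, hq0⟩ : ∃ q ∈ LinearMap.ker φ, q ≠ 0 := by
    refine (Submodule.ne_bot_iff _).1 (LinearMap.ker_ne_bot_of_finrank_lt ?_)
    rw [Module.finrank_fintype_fun_eq_card, Module.finrank_pi_fintype]
    simp
    omega
  have hqe : ∀ e, (q (s e) - q (t e)) ⬝ᵥ perp (fun k => x (.inl (e, k))) = 0 := fun e =>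
    congrFun (LinearMap.mem_ker.1 hq) (.inl e)
  have hql : ∀ l, (fun k => x (.inr (.inl (l, k)))) ⬝ᵥ q (b l) = 0 := fun l =>
    congrFun (LinearMap.mem_ker.1 hq) (.inr l)
  -- Along the line `p + ε • q` of realizations each edge collapses for at most one `ε`: two such
  -- values would give `q` equal ends, and then `p` itself would collapse the edge. Excluding `0`
  -- makes the new realization different from `p`.
  have hfin : (insert (0 : ℝ)
      (⋃ e, {ε : ℝ | p (s e) + ε • q (s e) = p (t e) + ε • q (t e)})).Finite := by
    refine (Set.finite_iUnion fun e => Set.Subsingleton.finite ?_).insert 0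
    intro ε hε δ hδ
    by_contra hne
    apply hpf e
    have h1 : (ε - δ) • (q (s e) - q (t e)) = 0 := by
      have hε' : p (s e) + ε • q (s e) = p (t e) + ε • q (t e) := hε
      have hδ' : p (s e) + δ • q (s e) = p (t e) + δ • q (t e) := hδ
      linear_combination (norm := module) hε' - hδ'
    have h2 : q (s e) = q (t e) :=
      sub_eq_zero.1 ((smul_eq_zero.1 h1).resolve_left (sub_ne_zero.2 hne))
    have hε' : p (s e) + ε • q (s e) = p (t e) + ε • q (t e) := hε
    rw [h2] at hε'
    exact add_right_cancel hε'
  obtain ⟨ε, hε⟩ := hfin.exists_notMem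
  simp only [Set.mem_insert_iff, Set.mem_iUnion, not_or, not_exists] at hε
  have h1 := huniq (fun v => p v + ε • q v) ⟨⟨fun e => ?_, fun l => ?_⟩, fun e => hε.2 e⟩
  · apply hq0
    ext v k
    simpa [hε.1] using congrFun (congrFun h1 v) k
  · rw [add_sub_add_comm, ← smul_sub, add_dotProduct, smul_dotProduct, hpe, hqe]
    simp
  · rw [dotProduct_add, dotProduct_smul, hpl, hql]
    simp

/-! ### Independent rows from Rado's theorem -/

/-- The tensor product of `u` and `w`. -/
def tensorRow (u : V → ℝ) : (Fin 2 → ℝ) →ₗ[ℝ] (V × Fin 2 → ℝ) where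
  toFun w vk := u vk.1 * w vk.2
  map_add' w w' := by ext; simp [mul_add]
  map_smul' a w := by ext; simp; ring

theorem tensorRow_dotProduct [Fintype V] (u : V → ℝ) (w : Fin 2 → ℝ) (q : V × Fin 2 → ℝ) :
    tensorRow u w ⬝ᵥ q = ∑ v, u v * (w ⬝ᵥ fun k => q (v, k)) := by
  simp [dotProduct, tensorRow, Fintype.sum_prod_type, mul_add, mul_assoc]

open Classical in
/-- The incidence vectors of edges and loops. -/
noncomputable def incidence : P ⊕ L → V → ℝ :=
  Sum.elim (fun e => Pi.single (s e) 1 - Pi.single (t e) 1) fun l => Pi.single (b l) 1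

theorem tensorRow_incidence_inl_dotProduct [Fintype V] (e : P) (w : Fin 2 → ℝ)
    (q : V × Fin 2 → ℝ) : tensorRow (incidence s t b (.inl e)) w ⬝ᵥ q =
      w ⬝ᵥ fun k => q (s e, k) - q (t e, k) := by
  classical
  rw [tensorRow_dotProduct]
  simp [incidence, Pi.single_apply, sub_mul, Finset.sum_sub_distrib, dotProduct]
  ring

theorem tensorRow_incidence_inr_dotProduct [Fintype V] (l : L) (w : Fin 2 → ℝ)
    (q : V × Fin 2 → ℝ) : tensorRow (incidence s t b (.inr l)) w ⬝ᵥ q =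
      w ⬝ᵥ fun k => q (b l, k) := by
  classical
  rw [tensorRow_dotProduct]
  simp [incidence, Pi.single_apply, dotProduct]

section

variable [Fintype V] [Fintype P] [Fintype L]

-- Rank is computed through the kernel. Evaluation `φ v` of kernel vectors at `v` agrees at the ends
-- of each edge of `S` and vanishes at the base of each loop of `S`, so the fibres of `φ` split `S`.
-- The kernel has dimension at most twice the number of nonzero values of `φ`. A fibre over a
-- nonzero value carries no loops and obeys the `(2,2)` count; the zero fibre obeys the `(2,0)`
-- count. Summing over fibres bounds `|S|` by the rank.
open Module in
theorem card_le_finrank_sup_range_tensorRow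
    (hsparse : ∀ X : Finset V, X.Nonempty → (inducedEdges s t X).card + 2 ≤ 2 * X.card)
    (hsparse' : ∀ X : Finset V, X.Nonempty →
      (inducedEdges s t X).card + (inducedLoops b X).card ≤ 2 * X.card)
    (S : Finset (P ⊕ L)) :
    S.card ≤ finrank ℝ
      ↥(S.sup fun i => LinearMap.range (tensorRow (incidence s t b i))) := by
  classical
  let B : Matrix (S × Fin 2) (V × Fin 2) ℝ := Matrix.of fun ik =>
    tensorRow (incidence s t b ik.1) (Pi.single ik.2 1)
  have hBsup : B.rank ≤ finrank ℝ
      ↥(S.sup fun i => LinearMap.range (tensorRow (incidence s t b i))) := by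
    rw [Matrix.rank_eq_finrank_span_row]
    refine Submodule.finrank_mono (Submodule.span_le.2 ?_)
    rintro _ ⟨⟨i, k⟩, rfl⟩
    exact Finset.le_sup (f := fun i => LinearMap.range (tensorRow (incidence s t b i))) i.2
      ⟨Pi.single k 1, rfl⟩
  have hrank := LinearMap.finrank_range_add_finrank_ker B.mulVecLin
  rw [← Matrix.rank, finrank_fintype_fun_eq_card, Fintype.card_prod, Fintype.card_fin] at hrank
  let φ : V → (LinearMap.ker B.mulVecLin →ₗ[ℝ] (Fin 2 → ℝ)) := fun v =>
    (LinearMap.funLeft ℝ ℝ fun k => (v, k)).comp (Submodule.subtype _)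
  have hφ : ∀ v q k, φ v q k = q.1 (v, k) := fun v q k => rfl
  have hzero : ∀ i ∈ S, ∀ k, ∀ q : LinearMap.ker B.mulVecLin,
      tensorRow (incidence s t b i) (Pi.single k 1) ⬝ᵥ q.1 = 0 := fun i hi k q =>
    congrFun (LinearMap.mem_ker.1 q.2) (⟨i, hi⟩, k)
  have hφe : ∀ e, .inl e ∈ S → φ (s e) = φ (t e) := by
    intro e he
    ext q k
    have := hzero _ he k q
    rw [tensorRow_incidence_inl_dotProduct, single_one_dotProduct] at this
    rw [hφ, hφ]
    exact sub_eq_zero.1 this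
  have hφl : ∀ l, .inr l ∈ S → φ (b l) = 0 := by
    intro l hl
    ext q k
    have := hzero _ hl k q
    rw [tensorRow_incidence_inr_dotProduct, single_one_dotProduct] at this
    exact this
  set C : Finset (LinearMap.ker B.mulVecLin →ₗ[ℝ] (Fin 2 → ℝ)) := Finset.univ.image φ with hC
  have hker : finrank ℝ (LinearMap.ker B.mulVecLin) ≤ (C.erase 0).card * 2 := by
    let ψ : LinearMap.ker B.mulVecLin →ₗ[ℝ] (↥(C.erase 0) → Fin 2 → ℝ) :=
      LinearMap.pi fun c => c.1
    have hψ : Function.Injective ψ := by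
      rw [← LinearMap.ker_eq_bot, LinearMap.ker_eq_bot']
      intro q hq
      ext ⟨v, k⟩
      by_cases h0 : φ v = 0
      · simpa [h0] using (hφ v q k).symm
      · exact congrFun (congrFun hq ⟨φ v, by simp [hC, h0]⟩) k
    have := LinearMap.finrank_le_finrank_of_injective hψ
    rwa [finrank_pi_fintype, finrank_fintype_fun_eq_card, Finset.sum_const, Finset.card_univ,
      Fintype.card_coe, Fintype.card_fin, smul_eq_mul] at this
  let ψ : P ⊕ L → (LinearMap.ker B.mulVecLin →ₗ[ℝ] (Fin 2 → ℝ)) :=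
    Sum.elim (fun e => φ (s e)) fun l => φ (b l)
  have hS : S.card = ∑ c ∈ C, (S.filter fun i => ψ i = c).card :=
    Finset.card_eq_sum_card_fiberwise fun i _ => by
      rcases i with e | l <;> simp [ψ, hC]
  have hV : Fintype.card V = ∑ c ∈ C, (Finset.univ.filter fun v => φ v = c).card :=
    Finset.card_eq_sum_card_fiberwise fun v _ => by simp [hC]
  have hfib : ∀ c ∈ C, (S.filter fun i => ψ i = c).card + (if c ≠ 0 then 2 else 0) ≤
      2 * (Finset.univ.filter fun v => φ v = c).card := by
    intro c hc
    set X : Finset V := Finset.univ.filter fun v => φ v = c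
    have hX : X.Nonempty := by
      obtain ⟨v, -, hv⟩ := Finset.mem_image.1 hc
      exact ⟨v, by simp [X, hv]⟩
    by_cases h0 : c = 0
    · have hsub : (S.filter fun i => ψ i = c) ⊆
          (inducedEdges s t X).disjSum (inducedLoops b X) := by
        rintro (e | l) hi
        · obtain ⟨hi, hi'⟩ := Finset.mem_filter.1 hi
          have hi'' : φ (s e) = c := hi'
          simp [X, hi'', ← hφe e hi]
        · obtain ⟨hi, hi'⟩ := Finset.mem_filter.1 hi
          have hi'' : φ (b l) = c := hi'
          simp [X, hi'']
      have h1 := Finset.card_le_card hsub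
      rw [Finset.card_disjSum] at h1
      have h2 := hsparse' X hX
      simp only [h0, ne_eq, not_true_eq_false, if_false] at h1 ⊢
      omega
    · have hsub : (S.filter fun i => ψ i = c) ⊆
          (inducedEdges s t X).map Function.Embedding.inl := by
        rintro (e | l) hi
        · obtain ⟨hi, hi'⟩ := Finset.mem_filter.1 hi
          have hi'' : φ (s e) = c := hi'
          simp [X, hi'', ← hφe e hi]
        · obtain ⟨hi, hi'⟩ := Finset.mem_filter.1 hi
          have hi'' : φ (b l) = c := hi'
          exact absurd (hi''.symm.trans (hφl l hi)) h0
      have h1 := Finset.card_le_card hsub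
      rw [Finset.card_map] at h1
      have h2 := hsparse X hX
      simp only [ne_eq, h0, not_false_eq_true, if_true]
      omega
  have hsum := Finset.sum_le_sum hfib
  rw [Finset.sum_add_distrib, ← hS, ← Finset.mul_sum, ← hV, ← Finset.sum_filter,
    Finset.sum_const, smul_eq_mul, Finset.filter_ne'] at hsum
  omega

/-- A `(2,0,2)`-graded-sparse multigraph has independent rows for suitable directions. -/
theorem exists_linearIndependent_tensorRow
    (hsparse : ∀ X : Finset V, X.Nonempty → (inducedEdges s t X).card + 2 ≤ 2 * X.card)
    (hsparse' : ∀ X : Finset V, X.Nonempty →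
      (inducedEdges s t X).card + (inducedLoops b X).card ≤ 2 * X.card) :
    ∃ w : P ⊕ L → Fin 2 → ℝ,
      LinearIndependent ℝ fun i => tensorRow (incidence s t b i) (w i) := by
  obtain ⟨r, hr, hLI⟩ := exists_linearIndependent_of_card_le_finrank_sup _
    (card_le_finrank_sup_range_tensorRow s t b hsparse hsparse')
  choose w hw using hr
  exact ⟨w, by simpa only [hw] using hLI⟩

end

/-! ### The linear system of a network -/

/-- The vectors orthogonal to the lines prescribed by the network. -/
def weight (x : ParamIndex P L → ℝ) : P ⊕ L → Fin 2 → ℝ :=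
  Sum.elim (fun e => perp fun k => x (.inl (e, k))) fun l k => x (.inr (.inl (l, k)))

theorem exists_weight_eq (w : P ⊕ L → Fin 2 → ℝ) (o : L → ℝ) :
    ∃ x : ParamIndex P L → ℝ, weight x = w ∧ ∀ l, x (.inr (.inr l)) = o l := by
  refine ⟨Sum.elim (fun ek => (![w (.inl ek.1) 1, -w (.inl ek.1) 0] : Fin 2 → ℝ) ek.2)
    (Sum.elim (fun lk => w (.inr lk.1) lk.2) o), ?_, fun l => rfl⟩
  ext (e | l) k
  · fin_cases k <;> simp [weight, perp]
  · rfl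

theorem exists_eval_eq_weight (i : P ⊕ L) (k : Fin 2) :
    ∃ f : MvPolynomial (ParamIndex P L) ℝ, ∀ x, eval x f = weight x i k := by
  rcases i with e | l
  · fin_cases k
    · exact ⟨-X (.inl (e, 1)), fun x => by simp [weight, perp]⟩
    · exact ⟨X (.inl (e, 0)), fun x => by simp [weight, perp]⟩
  · exact ⟨X (.inr (.inl (l, k))), fun x => by simp [weight]⟩

/-- The coefficient matrix of the linear system defining the realizations. -/
noncomputable def networkMatrix (x : ParamIndex P L → ℝ) : Matrix (P ⊕ L) (V × Fin 2) ℝ :=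
  Matrix.of fun i => tensorRow (incidence s t b i) (weight x i)

/-- The right-hand side of the linear system defining the realizations. -/
def networkRhs (x : ParamIndex P L → ℝ) : P ⊕ L → ℝ :=
  Sum.elim (fun _ => 0) fun l => x (.inr (.inr l))

theorem realizes_iff [Fintype V] (x : ParamIndex P L → ℝ) (p : V → Fin 2 → ℝ) :
    Realizes s t b x p ↔
      networkMatrix s t b x *ᵥ (fun vk => p vk.1 vk.2) = networkRhs x := by
  rw [funext_iff, Sum.forall]
  refine and_congr (forall_congr' fun e => ?_) (forall_congr' fun l => ?_)
  · rw [show (networkMatrix s t b x *ᵥ fun vk => p vk.1 vk.2) (.inl e) = _ from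
      tensorRow_incidence_inl_dotProduct s t b e _ _, dotProduct_comm]
    rfl
  · rw [show (networkMatrix s t b x *ᵥ fun vk => p vk.1 vk.2) (.inr l) = _ from
      tensorRow_incidence_inr_dotProduct s t b l _ _]
    rfl

theorem generic_linearIndependent_row_of_forall_eval {σ m n : Type*} [Fintype m] [Fintype n]
    (A : (σ → ℝ) → Matrix m n ℝ)
    (hA : ∀ i j, ∃ f : MvPolynomial σ ℝ, ∀ x, eval x f = A x i j) (x₀ : σ → ℝ)
    (h : LinearIndependent ℝ (A x₀).row) :
    Generic fun x => LinearIndependent ℝ (A x).row := by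
  choose f hf using hA
  have hmap : ∀ x, (Matrix.of f).map (eval x) = A x := fun x => Matrix.ext fun i j => hf i j x
  simpa only [hmap] using generic_linearIndependent_row (Matrix.of f) x₀ (by rwa [hmap])

theorem exists_eval_eq_networkMatrix (i : P ⊕ L) (j : V × Fin 2) :
    ∃ f : MvPolynomial (ParamIndex P L) ℝ, ∀ x, eval x f = networkMatrix s t b x i j := by
  obtain ⟨f, hf⟩ := exists_eval_eq_weight i j.2
  exact ⟨C (incidence s t b i j.1) * f, fun x => by simp [hf, networkMatrix, tensorRow]⟩

/-! ### Sufficiency of the counts -/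

section

variable [Fintype V] [Fintype P]

/-- If the edges stay independent after doubling `e₀`, then generically some parallel redrawing of
the loopless part does not collapse `e₀`. -/
theorem generic_exists_ne
    (hsparse : ∀ X : Finset V, (inducedEdges s t X).Nonempty →
      (inducedEdges s t X).card + 3 ≤ 2 * X.card) (e₀ : P) :
    ∃ w₀ : Fin 2 → ℝ, Generic fun x : ParamIndex P L → ℝ => ∃ q : V × Fin 2 → ℝ,
      (∀ e, (networkMatrix s t b x *ᵥ q) (.inl e) = 0) ∧
        tensorRow (incidence s t b (.inl e₀)) w₀ ⬝ᵥ q = 1 := by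
  classical
  -- The index `none` is a second copy of `e₀`, and loops are dropped. The extra edge costs one in
  -- the count only for those `X` that contain both ends of `e₀`.
  let s' : Option P → V := fun o => o.elim (s e₀) s
  let t' : Option P → V := fun o => o.elim (t e₀) t
  let b' : Empty → V := Empty.elim
  have h1 : ∀ X : Finset V, X.Nonempty → (inducedEdges s' t' X).card + 2 ≤ 2 * X.card := by
    intro X hX
    have hX1 := hX.card_pos
    have hX3 := hsparse X
    by_cases h0 : e₀ ∈ inducedEdges s t X
    · have h2 : inducedEdges s' t' X ⊆ (inducedEdges s t X).insertNone := by
        rintro (_ | e) <;> simp [s', t']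
      have h3 := Finset.card_le_card h2
      rw [Finset.card_insertNone] at h3
      have := hX3 ⟨_, h0⟩
      omega
    · have h2 : inducedEdges s' t' X ⊆ (inducedEdges s t X).map Function.Embedding.some := by
        rintro (_ | e) he
        · exact absurd (by simpa [s', t'] using he) h0
        · simpa [s', t'] using he
      have h3 := Finset.card_le_card h2
      rw [Finset.card_map] at h3
      rcases (inducedEdges s t X).eq_empty_or_nonempty with h4 | h4
      · rw [h4, Finset.card_empty] at h3
        omega
      · have := hX3 h4
        omega
  obtain ⟨w, hw⟩ := exists_linearIndependent_tensorRow s' t' b' h1 (by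
    intro X hX
    have := h1 X hX
    rw [Finset.eq_empty_of_isEmpty (inducedLoops b' X), Finset.card_empty]
    omega)
  let w₀ := w (.inl none)
  refine ⟨w₀, ?_⟩
  let A : (ParamIndex P L → ℝ) → Matrix (Option P) (V × Fin 2) ℝ := fun x => Matrix.of fun o =>
    o.elim (tensorRow (incidence s t b (.inl e₀)) w₀) fun e => networkMatrix s t b x (.inl e)
  obtain ⟨x₀, hx₀, -⟩ := exists_weight_eq (P := P) (L := L)
    (Sum.elim (fun e => w (.inl (some e))) 0) 0
  have hA : Generic fun x => LinearIndependent ℝ (A x).row := by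
    refine generic_linearIndependent_row_of_forall_eval A ?_ x₀ ?_
    · rintro (_ | e) j
      · exact ⟨C (tensorRow (incidence s t b (.inl e₀)) w₀ j), fun x => by simp [A]⟩
      · exact exists_eval_eq_networkMatrix s t b (.inl e) j
    · convert hw.comp Sum.inl Sum.inl_injective using 1
      ext (_ | e) j
      · rfl
      · simp [A, Matrix.row, networkMatrix, hx₀]
        rfl
  refine hA.mono fun x hx => ?_
  obtain ⟨q, hq⟩ := Matrix.mulVec_surjective_of_linearIndependent_row hx
    fun o => o.elim 1 fun _ => 0
  exact ⟨q, fun e => congrFun hq (some e), congrFun hq none⟩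

variable [Fintype L]

theorem generic_linearIndependent_networkMatrix
    (hsparse : ∀ X : Finset V, X.Nonempty → (inducedEdges s t X).card + 2 ≤ 2 * X.card)
    (hsparse' : ∀ X : Finset V, X.Nonempty →
      (inducedEdges s t X).card + (inducedLoops b X).card ≤ 2 * X.card) :
    Generic fun x => LinearIndependent ℝ (networkMatrix s t b x).row := by
  obtain ⟨w, hw⟩ := exists_linearIndependent_tensorRow s t b hsparse hsparse'
  obtain ⟨x₀, hx₀, -⟩ := exists_weight_eq w 0
  refine generic_linearIndependent_row_of_forall_eval _ (exists_eval_eq_networkMatrix s t b) x₀ ?_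
  rw [← hx₀] at hw
  exact hw

/-- A realization collapsing `e₀` would satisfy the additional homogeneous equation given by `r`.
Bordering the system by `r` and by its right-hand side gives a square matrix whose nonsingularity
excludes this; one good network then suffices for genericity. -/
theorem generic_forall_realizes_ne
    (hsparse : ∀ X : Finset V, (inducedEdges s t X).Nonempty →
      (inducedEdges s t X).card + 3 ≤ 2 * X.card)
    (hcard : Fintype.card P + Fintype.card L = 2 * Fintype.card V)
    (hLI : Generic fun x => LinearIndependent ℝ (networkMatrix s t b x).row) (e₀ : P) :
    Generic fun x => ∀ p, Realizes s t b x p → p (s e₀) ≠ p (t e₀) := by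
  obtain ⟨w₀, hw₀⟩ := generic_exists_ne s t b hsparse e₀
  set r := tensorRow (incidence s t b (.inl e₀)) w₀ with hr
  obtain ⟨x, ⟨q, hq, hq0⟩, hx⟩ := (hw₀.and hLI).exists
  -- The vector `q` already solves the edge equations; reading the offsets off from `q` makes it a
  -- realization without changing the matrix.
  obtain ⟨x₀, hx₀, hx₀'⟩ := exists_weight_eq (weight x)
    fun l => (networkMatrix s t b x *ᵥ q) (.inr l)
  have hM : networkMatrix s t b x₀ = networkMatrix s t b x := by
    rw [networkMatrix, hx₀, networkMatrix]
  have hMq : networkMatrix s t b x₀ *ᵥ q = networkRhs x₀ := by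
    rw [hM]
    ext (e | l)
    · exact hq e
    · exact (hx₀' l).symm
  let A : (ParamIndex P L → ℝ) → Matrix ((P ⊕ L) ⊕ Unit) ((V × Fin 2) ⊕ Unit) ℝ := fun y =>
    Matrix.fromBlocks (networkMatrix s t b y) (Matrix.of fun i _ => networkRhs y i)
      (Matrix.of fun _ => r) 0
  have hA : Generic fun y => LinearIndependent ℝ (A y).row := by
    refine generic_linearIndependent_row_of_forall_eval A ?_ x₀ ?_
    · rintro (i | _) (j | _)
      · exact exists_eval_eq_networkMatrix s t b i j
      · rcases i with e | l
        · exact ⟨0, fun y => by simp [A, networkRhs]⟩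
        · exact ⟨X (.inr (.inr l)), fun y => by simp [A, networkRhs]⟩
      · exact ⟨C (r j), fun y => by simp [A]⟩
      · exact ⟨0, fun y => by simp [A]⟩
    · rw [← hM] at hx
      rw [← Matrix.vecMul_injective_iff] at hx ⊢
      have hx' := (injective_iff_map_eq_zero (networkMatrix s t b x₀).vecMulLinear).1 hx
      refine (injective_iff_map_eq_zero (A x₀).vecMulLinear).2 fun c hc => ?_
      rw [Matrix.vecMulLinear_apply] at hc
      obtain ⟨c₁, c₂, rfl⟩ : ∃ c₁ c₂, c = Sum.elim c₁ c₂ :=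
        ⟨c ∘ .inl, c ∘ .inr, (Sum.elim_comp_inl_inr c).symm⟩
      have h1 : c₁ ᵥ* networkMatrix s t b x₀ + c₂ () • r = 0 := by
        ext j
        have := congrFun hc (.inl j)
        rw [Matrix.vecMul_fromBlocks] at this
        simpa [Matrix.vecMul, dotProduct] using this
      have h2 : c₁ ⬝ᵥ networkRhs x₀ = 0 := by
        have := congrFun hc (.inr ())
        rw [Matrix.vecMul_fromBlocks] at this
        simpa [Matrix.vecMul, dotProduct] using this
      -- Pairing the row relation with `q` leaves only `c₂`, because `M q` is the right-hand side,
      -- which `c₁` annihilates, and `r ⬝ᵥ q = 1`.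
      have h3 : c₂ () = 0 := by
        have := congrArg (· ⬝ᵥ q) h1
        simpa [add_dotProduct, ← Matrix.dotProduct_mulVec, hMq, h2, smul_dotProduct, hq0]
          using this
      rw [h3, zero_smul, add_zero] at h1
      have h4 : c₁ = 0 := hx' c₁ h1
      ext (i | i)
      · simp [h4]
      · exact h3
  refine hA.mono fun y hy p hp hne => ?_
  have hinj := Matrix.mulVec_injective_of_linearIndependent_row hy (by simp [hcard]; ring)
  rw [realizes_iff] at hp
  -- The vector `(p, -1)` would be a nonzero kernel vector of the bordered matrix.
  have h0 : A y *ᵥ Sum.elim (fun vk => p vk.1 vk.2) (fun _ => -1) = A y *ᵥ 0 := by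
    rw [Matrix.mulVec_zero]
    ext (i | _)
    · rw [Matrix.fromBlocks_mulVec]
      simp [hp, Matrix.mulVec, dotProduct, Function.comp_def]
    · rw [Matrix.fromBlocks_mulVec]
      have : r ⬝ᵥ (fun vk => p vk.1 vk.2) = 0 := by
        rw [hr, tensorRow_incidence_inl_dotProduct]
        simp [hne, dotProduct]
      simpa [Matrix.mulVec] using this
  have := congrFun (hinj h0) (.inr ())
  simp at this

theorem generic_existsUnique_faithfullyRealizes
    (hsparse : ∀ X : Finset V, (inducedEdges s t X).Nonempty →
      (inducedEdges s t X).card + 3 ≤ 2 * X.card)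
    (hsparse' : ∀ X : Finset V,
      (inducedEdges s t X).card + (inducedLoops b X).card ≤ 2 * X.card)
    (hcard : Fintype.card P + Fintype.card L = 2 * Fintype.card V) :
    Generic fun x => ∃! p, FaithfullyRealizes s t b x p := by
  -- The `(2,3)` count implies the `(2,2)` count; when `X` induces no edge, the latter only says
  -- that `X` is nonempty.
  have hLI := generic_linearIndependent_networkMatrix s t b (fun X hX => by
    have := hX.card_pos
    rcases (inducedEdges s t X).eq_empty_or_nonempty with h | h
    · rw [h, Finset.card_empty]
      omega
    · have := hsparse X h
      omega) fun X _ => hsparse' X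
  refine (hLI.and (Generic.forall fun e =>
    generic_forall_realizes_ne s t b hsparse hcard hLI e)).mono ?_
  rintro x ⟨hx, hne⟩
  obtain ⟨q, hq⟩ := Matrix.mulVec_surjective_of_linearIndependent_row hx (networkRhs x)
  have hreal : Realizes s t b x fun v k => q (v, k) := (realizes_iff s t b x _).2 hq
  refine ⟨fun v k => q (v, k), ⟨hreal, fun e => hne e _ hreal⟩, ?_⟩
  rintro p ⟨hp, -⟩
  rw [realizes_iff, ← hq] at hp
  have := Matrix.mulVec_injective_of_linearIndependent_row hx (by simp [hcard]; ring) hp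
  ext v k
  exact congrFun this (v, k)

/-- The `(2,0,3)`-sparsity counts, on induced submultigraphs. -/
def IsLamanSparse : Prop :=
  (∀ X : Finset V, (inducedEdges s t X).Nonempty →
    (inducedEdges s t X).card + 3 ≤ 2 * X.card) ∧
  ∀ X : Finset V, (inducedEdges s t X).card + (inducedLoops b X).card ≤ 2 * X.card

theorem generic_faithfullyRealizes_iff :
    Generic fun x =>
      ((∃! p, FaithfullyRealizes s t b x p) ↔ IsLamanSparse s t b ∧
        Fintype.card P + Fintype.card L = 2 * Fintype.card V) ∧
      (Fintype.card P + Fintype.card L = 2 * Fintype.card V →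
        ((∃ p, FaithfullyRealizes s t b x p) ↔ IsLamanSparse s t b ∧
          Fintype.card P + Fintype.card L = 2 * Fintype.card V)) := by
  by_cases h1 : ∀ X : Finset V, (inducedEdges s t X).Nonempty →
      (inducedEdges s t X).card + 3 ≤ 2 * X.card
  swap
  · push Not at h1
    obtain ⟨X, hX, hX'⟩ := h1
    refine (generic_not_exists_faithfullyRealizes_of_card_lt_add_three s t b X hX hX').mono ?_
    intro x hx
    have h3 := fun h => hx (ExistsUnique.exists h)
    have h4 := fun h : IsLamanSparse s t b => (h.1 X hX).not_gt hX'
    tauto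
  by_cases h2 : ∀ X : Finset V,
      (inducedEdges s t X).card + (inducedLoops b X).card ≤ 2 * X.card
  swap
  · push Not at h2
    obtain ⟨X, hX⟩ := h2
    refine (generic_not_exists_faithfullyRealizes_of_card_lt s t b X hX).mono ?_
    intro x hx
    have h3 := fun h => hx (ExistsUnique.exists h)
    have h4 := fun h : IsLamanSparse s t b => (h.2 X).not_gt hX
    tauto
  by_cases h3 : Fintype.card P + Fintype.card L = 2 * Fintype.card V
  · refine (generic_existsUnique_faithfullyRealizes s t b h1 h2 h3).mono fun x hx => ?_
    have h4 := hx.exists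
    have h5 : IsLamanSparse s t b := ⟨h1, h2⟩
    tauto
  -- The count on the whole vertex set turns failure of tightness into a strict deficit of
  -- equations.
  · have h4 := h2 Finset.univ
    have h5 : inducedEdges s t Finset.univ = Finset.univ := by ext; simp
    have h6 : inducedLoops b Finset.univ = Finset.univ := by ext; simp
    rw [h5, h6, Finset.card_univ, Finset.card_univ, Finset.card_univ] at h4
    refine Generic.of_forall fun x => ?_
    have h7 := not_existsUnique_faithfullyRealizes s t b (by omega) x
    tauto

end

end Multigraph

end DirectionSliderNetwork

/-! ### Translation from `Graph` to indexed edges and loops -/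

namespace Graph

variable {α β : Type*} {G : Graph α β}

/-- The underlying edge. -/
def ProperEdge.edge (e : G.ProperEdge) : β := e.1

/-- The underlying loop. -/
def LoopEdge.edge (l : G.LoopEdge) : β := l.1

theorem ProperEdge.edge_injective : Function.Injective (ProperEdge.edge (G := G)) :=
  Subtype.val_injective

theorem LoopEdge.edge_injective : Function.Injective (LoopEdge.edge (G := G)) :=
  Subtype.val_injective

theorem exists_ends_properEdge (e : G.ProperEdge) :
    ∃ i j : V(G), i ≠ j ∧ G.IsLink e.1 i j := by
  obtain ⟨x, y, hyx, h⟩ := e.2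
  exact ⟨⟨x, h.left_mem⟩, ⟨y, h.right_mem⟩, fun h' => hyx (congrArg Subtype.val h').symm, h⟩

theorem exists_base_loopEdge (l : G.LoopEdge) : ∃ i : V(G), G.IsLoopAt l.1 i := by
  obtain ⟨x, h⟩ := l.2
  exact ⟨⟨x, h.vertex_mem⟩, h⟩

theorem edge_cases {e : β} (he : e ∈ E(G)) :
    (∃ e' : G.ProperEdge, e'.edge = e) ∨ ∃ l : G.LoopEdge, l.edge = e := by
  obtain ⟨x, y, h⟩ := exists_isLink_of_mem_edgeSet he
  rcases h.inc_left.isLoopAt_or_isNonloopAt with h | h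
  · exact .inr ⟨⟨e, x, h⟩, rfl⟩
  · exact .inl ⟨⟨e, x, h⟩, rfl⟩

theorem properEdge_ne_loopEdge (e : G.ProperEdge) (l : G.LoopEdge) :
    e.edge ≠ l.edge := by
  obtain ⟨e, x, hx⟩ := e
  obtain ⟨l, y, hy⟩ := l
  rintro (rfl : e = l)
  exact hx.not_isLoopAt y hy

instance [Finite E(G)] : Finite G.ProperEdge :=
  Finite.of_injective (fun e : G.ProperEdge => (⟨e.1, e.2.choose_spec.edge_mem⟩ : E(G)))
    fun _ _ h => Subtype.ext (congrArg (fun a : E(G) => a.1) h)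

instance [Finite E(G)] : Finite G.LoopEdge :=
  Finite.of_injective (fun l : G.LoopEdge => (⟨l.1, l.2.choose_spec.edge_mem⟩ : E(G)))
    fun _ _ h => Subtype.ext (congrArg (fun a : E(G) => a.1) h)

/-- The members of `β` given by a set of edges and a set of loops. -/
def edgeUnion (S : Finset G.ProperEdge) (T : Finset G.LoopEdge) : Set β :=
  ProperEdge.edge '' (S : Set G.ProperEdge) ∪ LoopEdge.edge '' (T : Set G.LoopEdge)

theorem finite_edgeUnion (S : Finset G.ProperEdge) (T : Finset G.LoopEdge) :
    (edgeUnion S T).Finite := (S.finite_toSet.image _).union (T.finite_toSet.image _)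

theorem ncard_edgeUnion (S : Finset G.ProperEdge) (T : Finset G.LoopEdge) :
    (edgeUnion S T).ncard = S.card + T.card := by
  rw [edgeUnion, Set.ncard_union_eq _ (S.finite_toSet.image _) (T.finite_toSet.image _),
    Set.ncard_image_of_injective _ ProperEdge.edge_injective,
    Set.ncard_image_of_injective _ LoopEdge.edge_injective, Set.ncard_coe_finset,
    Set.ncard_coe_finset]
  rw [Set.disjoint_left]
  rintro _ ⟨e, -, rfl⟩ ⟨l, -, h⟩
  exact properEdge_ne_loopEdge e l h.symm

open DirectionSliderNetwork

section

variable {s t : G.ProperEdge → V(G)} {b : G.LoopEdge → V(G)}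

theorem edgeSet_induce_eq_edgeUnion [Fintype G.ProperEdge] [Fintype G.LoopEdge]
    (hst : ∀ e, s e ≠ t e ∧ G.IsLink e.1 (s e) (t e)) (hb : ∀ l, G.IsLoopAt l.1 (b l))
    (X : Finset V(G)) :
    E(G.induce (Subtype.val '' (X : Set V(G)))) =
      edgeUnion (inducedEdges s t X) (inducedLoops b X) := by
  ext e
  constructor
  · rintro ⟨x, y, h, ⟨x, hx, rfl⟩, ⟨y, hy, rfl⟩⟩
    rw [Finset.mem_coe] at hx hy
    obtain ⟨e, rfl⟩ | ⟨l, rfl⟩ := edge_cases h.edge_mem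
    · refine .inl ⟨e, ?_, rfl⟩
      obtain ⟨h1, h2⟩ | ⟨h1, h2⟩ := (hst e).2.eq_and_eq_or_eq_and_eq h <;>
      simp [Subtype.ext h1, Subtype.ext h2, hx, hy]
    · refine .inr ⟨l, ?_, rfl⟩
      have h1 := Subtype.ext ((hb l).eq_of_inc h.inc_left)
      simpa [h1] using hx
  · rintro (⟨e, he, rfl⟩ | ⟨l, hl, rfl⟩)
    · have he := mem_inducedEdges.1 (Finset.mem_coe.1 he)
      exact ⟨_, _, (hst e).2, ⟨_, he.1, rfl⟩, ⟨_, he.2, rfl⟩⟩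
    · have hl := mem_inducedLoops.1 (Finset.mem_coe.1 hl)
      exact ⟨_, _, hb l, ⟨_, hl, rfl⟩, ⟨_, hl, rfl⟩⟩

/-- Induced subgraphs, with or without their loops, have the most edges on a given vertex set, so
they decide both counts. -/
theorem isGradedSparse203_iff [Fintype V(G)] [Fintype G.ProperEdge] [Fintype G.LoopEdge]
    (hst : ∀ e, s e ≠ t e ∧ G.IsLink e.1 (s e) (t e)) (hb : ∀ l, G.IsLoopAt l.1 (b l)) :
    G.IsGradedSparse203 ↔ IsLamanSparse s t b := by
  classical
  constructor
  · rintro ⟨h1, h2⟩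
    have hle : ∀ X : Finset V(G), G.induce (Subtype.val '' (X : Set V(G))) ≤ G := fun X =>
      induce_le (by rintro _ ⟨v, -, rfl⟩; exact v.2)
    have hV : ∀ X : Finset V(G),
        V(G.induce (Subtype.val '' (X : Set V(G)))).ncard = X.card := fun X => by
      rw [vertexSet_induce, Set.ncard_image_of_injective _ Subtype.val_injective,
        Set.ncard_coe_finset]
    refine ⟨fun X hX => ?_, fun X => ?_⟩
    · set H := (G.induce (Subtype.val '' (X : Set V(G)))).restrict
        (ProperEdge.edge '' (inducedEdges s t X : Set G.ProperEdge)) with hH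
      have hHG : H ≤ G := restrict_le.trans (hle X)
      have hHE : E(H) = edgeUnion (inducedEdges s t X) ∅ := by
        rw [hH, edgeSet_restrict, edgeSet_induce_eq_edgeUnion hst hb, edgeUnion, edgeUnion,
          Finset.coe_empty, Set.image_empty, Set.union_empty]
        exact Set.inter_eq_right.2 Set.subset_union_left
      have hloop : H.Loopless := by
        refine ⟨fun e x hex => ?_⟩
        have he := hex.edge_mem
        rw [hHE] at he
        obtain ⟨e, -, rfl⟩ | ⟨l, hl, -⟩ := he
        · exact properEdge_ne_loopEdge e ⟨e.1, x, hex.mono hHG⟩ rfl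
        · simp at hl
      have h3 := h1 H hHG hloop H le_rfl (by
        rw [hHE]
        obtain ⟨e, he⟩ := hX
        exact ⟨e.1, .inl ⟨e, he, rfl⟩⟩)
      rwa [hHE, ncard_edgeUnion, hH, vertexSet_restrict, hV] at h3
    · rcases Set.eq_empty_or_nonempty E(G.induce (Subtype.val '' (X : Set V(G)))) with h0 | h0
      · rw [← ncard_edgeUnion, ← edgeSet_induce_eq_edgeUnion hst hb, h0]
        simp
      · have h3 := h2 _ (hle X) _ le_rfl h0
        rwa [edgeSet_induce_eq_edgeUnion hst hb, ncard_edgeUnion, hV] at h3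
  · rintro ⟨h1, h2⟩
    have key : ∀ H ≤ G, ∃ X : Finset V(G), V(H).ncard = X.card ∧
        E(H) ⊆ edgeUnion (inducedEdges s t X) (inducedLoops b X) := by
      intro H hH
      have hX : Subtype.val '' ((Finset.univ.filter fun v : V(G) => v.1 ∈ V(H) : Finset V(G)) :
          Set V(G)) = V(H) := by
        ext v
        simpa using fun h => hH.vertexSet_mono h
      refine ⟨Finset.univ.filter fun v : V(G) => v.1 ∈ V(H), ?_, ?_⟩
      · rw [← Set.ncard_coe_finset, ← Set.ncard_image_of_injective _ Subtype.val_injective, hX]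
      · rw [← edgeSet_induce_eq_edgeUnion hst hb, hX]
        intro e he
        obtain ⟨x, y, h⟩ := exists_isLink_of_mem_edgeSet he
        exact ⟨x, y, h.mono hH, h.left_mem, h.right_mem⟩
    refine ⟨fun H hH hloop H' hH' hne => ?_, fun H hH H' hH' hne => ?_⟩
    · obtain ⟨X, hX, hE⟩ := key H' (hH'.trans hH)
      have hE' : E(H') ⊆ edgeUnion (inducedEdges s t X) ∅ := by
        intro e he
        obtain h | ⟨l, -, rfl⟩ := hE he
        · exact .inl h
        · have h3 : H'.IsLoopAt l.1 (b l) := ((hH'.trans hH).isLoopAt_congr he).2 (hb l)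
          exact absurd (h3.mono hH') (hloop.not_isLoopAt _ _)
      have h3 := Set.ncard_le_ncard hE' (finite_edgeUnion _ _)
      rw [ncard_edgeUnion, Finset.card_empty] at h3
      have h4 : (inducedEdges s t X).Nonempty := by
        obtain ⟨e, he⟩ := hne
        obtain ⟨e, he, -⟩ | ⟨l, hl, -⟩ := hE' he
        · exact ⟨e, he⟩
        · simp at hl
      have := h1 X h4
      omega
    · obtain ⟨X, hX, hE⟩ := key H' (hH'.trans hH)
      have h3 := Set.ncard_le_ncard hE (finite_edgeUnion _ _)
      rw [ncard_edgeUnion] at h3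
      have := h2 X
      omega

end

theorem ncard_edgeSet_eq [Fintype G.ProperEdge] [Fintype G.LoopEdge] :
    E(G).ncard = Fintype.card G.ProperEdge + Fintype.card G.LoopEdge := by
  rw [← Finset.card_univ, ← Finset.card_univ, ← ncard_edgeUnion]
  congr 1
  ext e
  constructor
  · intro he
    obtain ⟨e, rfl⟩ | ⟨l, rfl⟩ := edge_cases he
    · exact .inl ⟨e, by simp, rfl⟩
    · exact .inr ⟨l, by simp, rfl⟩
  · rintro (⟨e, -, rfl⟩ | ⟨l, -, rfl⟩)
    · exact e.2.choose_spec.edge_mem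
    · exact l.2.choose_spec.edge_mem

end Graph

/-! ### Transfer of realizations and genericity to the original network -/

namespace DirectionSliderNetwork

variable {α β : Type*} {G : Graph α β}

theorem isFaithfulRealization_iff {s t : G.ProperEdge → V(G)} {b : G.LoopEdge → V(G)}
    (hst : ∀ e, s e ≠ t e ∧ G.IsLink e.1 (s e) (t e)) (hb : ∀ l, G.IsLoopAt l.1 (b l))
    (N : DirectionSliderNetwork G) (p : V(G) → Fin 2 → ℝ) :
    N.IsFaithfulRealization p ↔ FaithfullyRealizes s t b N.coords p := by
  constructor
  · rintro ⟨⟨h1, h2⟩, h3⟩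
    exact ⟨⟨fun e => h1 e _ _ (hst e).2, fun l => h2 l _ (hb l)⟩, fun e => h3 e _ _ (hst e).2⟩
  · rintro ⟨⟨h1, h2⟩, h3⟩
    refine ⟨⟨fun e i j hij => ?_, fun l i hi => ?_⟩, fun e i j hij => ?_⟩
    · have h4 : (p (s e) - p (t e)) ⬝ᵥ perp (N.dir e) = 0 := h1 e
      obtain ⟨hi, hj⟩ | ⟨hi, hj⟩ := (hst e).2.eq_and_eq_or_eq_and_eq hij <;>
      rw [Subtype.ext hi, Subtype.ext hj] at h4
      · exact h4
      · rw [← neg_sub, neg_dotProduct, h4, neg_zero]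
    · rw [← Subtype.ext ((hb l).eq_of_inc hi.inc)]
      exact h2 l
    · have h4 := h3 e
      obtain ⟨hi, hj⟩ | ⟨hi, hj⟩ := (hst e).2.eq_and_eq_or_eq_and_eq hij <;>
      rw [Subtype.ext hi, Subtype.ext hj] at h4
      · exact h4
      · exact h4.symm

theorem holdsGenerically_of_generic {Q : DirectionSliderNetwork G → Prop}
    {R : (Coord G → ℝ) → Prop} (hR : MvPolynomial.Generic R) (h : ∀ N, R N.coords → Q N) :
    HoldsGenerically G Q := by
  obtain ⟨f, hf, hfR⟩ := hR
  exact ⟨{f}, ⟨f, by simp, hf⟩, fun N hN => h N (hfR _ (by simpa using hN))⟩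

end DirectionSliderNetwork

open DirectionSliderNetwork in
theorem theorem4 {α β : Type*} (G : Graph α β) (hV : V(G).Finite) (hE : E(G).Finite) :
    DirectionSliderNetwork.HoldsGenerically G fun N =>
      ((∃! p : V(G) → Fin 2 → ℝ, N.IsFaithfulRealization p) ↔ G.IsLoopedLaman) ∧
      (E(G).ncard = 2 * V(G).ncard →
        ((∃ p : V(G) → Fin 2 → ℝ, N.IsFaithfulRealization p) ↔ G.IsLoopedLaman)) := by
  have := hV.fintype
  have := hE.to_subtype
  have := Fintype.ofFinite G.ProperEdge
  have := Fintype.ofFinite G.LoopEdge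
  choose s t hst using G.exists_ends_properEdge
  choose b hb using G.exists_base_loopEdge
  refine holdsGenerically_of_generic (generic_faithfullyRealizes_iff s t b) fun N hN => ?_
  rw [Graph.IsLoopedLaman, Graph.isGradedSparse203_iff hst hb, Graph.ncard_edgeSet_eq,
    ← Nat.card_coe_set_eq, Nat.card_eq_fintype_card]
  simpa only [isFaithfulRealization_iff hst hb] using hN
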